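/- Let $K$ be an ordered field with its order topology. Assume that - $K$ is non-Archimedean; - $K$ is maximal ordered (i.e. real closed): every ordered field $L$ that is an algebraic extension of $K$ and whose order extends that of $K$ coincides with $K$; - $K$ is Cauchy complete for the uniform structure of its ordered additive group; - $0$ has a countable basis of neighbourhoods in $K$. For a power series $S(X)=\sum_{n\ge 0}a_nX^n$ with $a_n\in K$, say that $S$ converges at $x\in K$ with value $S(x)$ if the partial sums $\sum_{i=0}^{n}a_ix^i$ converge to $S(x)$ in $K$ as $n\to\infty$. Let $a<b$ be elements of $K$ and let $S$ be a power series over $K$ that converges at every point of $[a,b]=\{x\in K: a\le x\le b\}$ and satisfies $S(a)S(b)<0$. Then there is $c\in K$ with $a<c<b$ and $S(c)=0$. -/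

import Mathlib

open Filter Topology

universe u

/-- An ordered field `K` is *maximal ordered* if every ordered algebraic extension of `K`
coincides with `K`. An ordered extension is an ordered field `L` with an order-preserving
embedding `K → L`. An algebraic extension of `K` has at most `max (#K) ℵ₀ = #K` elements, so it is
isomorphic to one in the universe of `K`. -/
def IsMaximalOrdered (K : Type u) [Field K] [LinearOrder K] [IsStrictOrderedRing K] : Prop :=
  ∀ (L : Type u) [Field L] [LinearOrder L] [IsStrictOrderedRing L] [Algebra K L],
    StrictMono (algebraMap K L) → Algebra.IsAlgebraic K L →
      Function.Surjective (algebraMap K L)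

/-- The power series `S = ∑ aₙ Xⁿ` converges at `x` with value `S(x) = s`: the partial sums
`Sₙ(x) = ∑_{i=0}^n aᵢ xⁱ` tend to `s`. -/
def PowerSeries.ConvergesAtTo {K : Type u} [Field K] [TopologicalSpace K]
    (S : PowerSeries K) (x s : K) : Prop :=
  Tendsto (fun n : ℕ => ∑ i ∈ Finset.range (n + 1), PowerSeries.coeff i S * x ^ i) atTop (𝓝 s)

/-!
Polynomials over a maximal ordered field satisfy the intermediate value theorem
(`IsMaximalOrdered.exists_mem_Ioo_isRoot`): if an irreducible `P` changes sign, then `-1` is not a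
nonnegative combination of squares modulo `P`, by descent on the degree
(`not_dvd_one_add_of_eval_mul_eval_neg`), so `K[X]/(P)` has an ordering extending that of `K`
(`exists_linearOrder_of_subsemiring`) and must be `K` itself.

For a power series `S`, rescaling by the absolute value of an endpoint brings `[a, b]` into the unit
ball of the Archimedean valuation `ArchimedeanClass.mk` (written additively: negligible elements
have large values), with coefficients of `S` tending to zero. The truncations of `S` eventually
change sign between `a` and `b`, hence have roots `c n` there. These roots need not converge, but
they form a totally bounded sequence (`exists_clusterPt_of_eval_trunc_eq_zero`): some
nonzero coefficient of `S` strictly dominates all later ones, and on the unit ball the set where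
such a polynomial is small is covered by finitely many small balls
(`exists_finite_cover_of_archimedeanClass_mk_eval`). By completeness the `c n` have a cluster point,
and there `S` vanishes (`eq_zero_of_clusterPt_of_convergesAtTo`), because truncations converge
uniformly on the unit ball.
-/

/-! ### The intermediate value theorem for polynomials -/

open Polynomial in
theorem Polynomial.exists_irreducible_dvd_eval_mul_eval_neg {K : Type u} [Field K] [LinearOrder K]
    [IsStrictOrderedRing K] {a b : K} (H : K[X]) (hH : H.eval a * H.eval b < 0) :
    ∃ G : K[X], Irreducible G ∧ G ∣ H ∧ G.eval a * G.eval b < 0 := by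
  induction H using WfDvdMonoid.induction_on_irreducible with
  | zero => simp at hH
  | unit u hu =>
    obtain ⟨r, -, rfl⟩ := Polynomial.isUnit_iff.1 hu
    simp only [eval_C] at hH
    exact absurd hH (mul_self_nonneg r).not_gt
  | mul A i _ hi ih =>
    by_cases h : i.eval a * i.eval b < 0
    · exact ⟨i, hi, dvd_mul_right _ _, h⟩
    · have hA : A.eval a * A.eval b < 0 := by
        by_contra hA
        have := mul_nonneg (not_lt.1 h) (not_lt.1 hA)
        simp only [eval_mul] at hH
        linarith [mul_mul_mul_comm (i.eval a) (i.eval b) (A.eval a) (A.eval b)]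
      obtain ⟨G, hG, hd, hs⟩ := ih hA
      exact ⟨G, hG, hd.mul_left _, hs⟩

/-- The elements of a `K`-algebra `A` of the form `k • y ^ 2` with `0 ≤ k`. -/
def nonnegSMulSq (K : Type u) [Field K] [LinearOrder K] [IsStrictOrderedRing K]
    (A : Type*) [CommRing A] [Algebra K A] : Submonoid A where
  carrier := {x | ∃ k : K, 0 ≤ k ∧ ∃ y : A, x = algebraMap K A k * y ^ 2}
  one_mem' := ⟨1, zero_le_one, 1, by simp⟩
  mul_mem' := by
    rintro _ _ ⟨k, hk, y, rfl⟩ ⟨l, hl, z, rfl⟩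
    exact ⟨k * l, mul_nonneg hk hl, y * z, by simp only [map_mul]; ring⟩

theorem algebraMap_mul_sq_mem_subsemiringClosure {K : Type u} [Field K] [LinearOrder K]
    [IsStrictOrderedRing K] {A : Type*} [CommRing A] [Algebra K A] {k : K} (hk : 0 ≤ k) (y : A) :
    algebraMap K A k * y ^ 2 ∈ (nonnegSMulSq K A).subsemiringClosure :=
  (Submonoid.subsemiringClosure_mem _).2 (AddSubmonoid.subset_closure ⟨k, hk, y, rfl⟩)

open Polynomial in
theorem eval_nonneg_of_mem_subsemiringClosure {K : Type u} [Field K] [LinearOrder K]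
    [IsStrictOrderedRing K] {t : K[X]} (ht : t ∈ (nonnegSMulSq K K[X]).subsemiringClosure) (x : K) :
    0 ≤ t.eval x := by
  rw [Submonoid.subsemiringClosure_mem] at ht
  induction ht using AddSubmonoid.closure_induction with
  | mem t ht =>
    obtain ⟨k, hk, y, rfl⟩ := ht
    simp only [algebraMap_eq, eval_mul, eval_C, eval_pow]
    positivity
  | zero => simp
  | add s t _ _ hs ht => simpa using add_nonneg hs ht

open Polynomial in
/-- Reducing the squared polynomials modulo `P` bounds the degree of a nonnegative combination of
squares. -/
theorem exists_natDegree_le_dvd_sub_of_mem_subsemiringClosure {K : Type u} [Field K] [LinearOrder K]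
    [IsStrictOrderedRing K] {P : K[X]} (hP : 0 < P.natDegree) {t : K[X]}
    (ht : t ∈ (nonnegSMulSq K K[X]).subsemiringClosure) :
    ∃ s ∈ (nonnegSMulSq K K[X]).subsemiringClosure,
      s.natDegree ≤ 2 * (P.natDegree - 1) ∧ P ∣ t - s := by
  rw [Submonoid.subsemiringClosure_mem] at ht
  induction ht using AddSubmonoid.closure_induction with
  | mem t ht =>
    obtain ⟨k, hk, y, rfl⟩ := ht
    refine ⟨C k * (y % P) ^ 2, ?_, ?_, ?_⟩
    · exact algebraMap_mul_sq_mem_subsemiringClosure hk _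
    · have h := natDegree_mod_lt y hP.ne'
      refine (natDegree_C_mul_le _ _).trans (natDegree_pow_le.trans ?_)
      exact Nat.mul_le_mul_left _ (by omega)
    · have : P ∣ y - y % P :=
        ⟨y / P, by linear_combination - EuclideanDomain.div_add_mod y P⟩
      have e : algebraMap K K[X] k * y ^ 2 - C k * (y % P) ^ 2
          = (y - y % P) * (C k * (y + y % P)) := by rw [algebraMap_eq]; ring
      rw [e]
      exact this.mul_right _
  | zero => exact ⟨0, zero_mem _, by simp, by simp⟩
  | add s t _ _ hs ht =>
    obtain ⟨s', hs, hs1, hs2⟩ := hs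
    obtain ⟨t', ht, ht1, ht2⟩ := ht
    refine ⟨s' + t', add_mem hs ht, natDegree_add_le_of_degree_le hs1 ht1, ?_⟩
    rw [add_sub_add_comm]
    exact dvd_add hs2 ht2

open Polynomial in
/-- Descent on the degree: if an irreducible `P` with a sign change divides `1 + t`, then, `t` being
reduced modulo `P`, the cofactor also has a sign change, and smaller degree than `P`. -/
theorem not_dvd_one_add_of_eval_mul_eval_neg {K : Type u} [Field K] [LinearOrder K]
    [IsStrictOrderedRing K] {a b : K} (P : K[X]) (hP : Irreducible P)
    (hab : P.eval a * P.eval b < 0) {t : K[X]}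
    (ht : t ∈ (nonnegSMulSq K K[X]).subsemiringClosure) : ¬ P ∣ 1 + t := by
  induction hn : P.natDegree using Nat.strong_induction_on generalizing P t with
  | _ n ih =>
  subst hn
  intro hdvd
  have hP0 : 0 < P.natDegree := hP.natDegree_pos
  obtain ⟨s, hs, hsd, hst⟩ := exists_natDegree_le_dvd_sub_of_mem_subsemiringClosure hP0 ht
  obtain ⟨H, hH⟩ : P ∣ 1 + s := by
    have := dvd_sub hdvd hst
    rwa [show 1 + t - (t - s) = 1 + s by ring] at this
  have ha := eval_nonneg_of_mem_subsemiringClosure hs a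
  have hb := eval_nonneg_of_mem_subsemiringClosure hs b
  have hea := congrArg (eval a) hH
  have heb := congrArg (eval b) hH
  simp only [eval_add, eval_one, eval_mul] at hea heb
  have hHab : H.eval a * H.eval b < 0 := by
    have h1 : 0 < (P.eval a * P.eval b) * (H.eval a * H.eval b) := by
      rw [mul_mul_mul_comm, ← hea, ← heb]; positivity
    exact neg_of_mul_pos_right h1 hab.le
  obtain ⟨G, hG, hGH, hGab⟩ := exists_irreducible_dvd_eval_mul_eval_neg H hHab
  have hH0 : H ≠ 0 := by rintro rfl; simp at hHab
  have hdeg : P.natDegree + H.natDegree ≤ 2 * (P.natDegree - 1) := by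
    rw [← natDegree_mul hP.ne_zero hH0, ← hH]
    exact natDegree_add_le_of_degree_le (by simp) hsd
  have hGd := natDegree_le_of_dvd hGH hH0
  exact ih G.natDegree (by omega) G hG hGab hs rfl (hH ▸ hGH.mul_left P)

open Polynomial in
/-- If an irreducible `P` changes sign, the nonnegative combinations of squares form a preordering
of `K[X]/(P)`. -/
theorem neg_one_notMem_subsemiringClosure_adjoinRoot {K : Type u} [Field K] [LinearOrder K]
    [IsStrictOrderedRing K] {a b : K} (P : K[X]) (hP : Irreducible P)
    (hab : P.eval a * P.eval b < 0) :
    -1 ∉ (nonnegSMulSq K (AdjoinRoot P)).subsemiringClosure := by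
  have lift : ∀ x ∈ (nonnegSMulSq K (AdjoinRoot P)).subsemiringClosure,
      ∃ t ∈ (nonnegSMulSq K K[X]).subsemiringClosure, AdjoinRoot.mk P t = x := by
    intro x hx
    rw [Submonoid.subsemiringClosure_mem] at hx
    induction hx using AddSubmonoid.closure_induction with
    | mem x hx =>
      obtain ⟨k, hk, y, rfl⟩ := hx
      obtain ⟨q, rfl⟩ := AdjoinRoot.mk_surjective y
      refine ⟨algebraMap K K[X] k * q ^ 2, algebraMap_mul_sq_mem_subsemiringClosure hk q, ?_⟩
      simp [AdjoinRoot.algebraMap_eq]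
    | zero => exact ⟨0, zero_mem _, map_zero _⟩
    | add s t _ _ hs ht =>
      obtain ⟨s', hs, rfl⟩ := hs
      obtain ⟨t', ht, rfl⟩ := ht
      exact ⟨s' + t', add_mem hs ht, map_add _ _ _⟩
  intro h
  obtain ⟨t, ht, e⟩ := lift _ h
  refine not_dvd_one_add_of_eval_mul_eval_neg P hP hab ht (AdjoinRoot.mk_eq_zero.1 ?_)
  rw [map_add, map_one, e, add_neg_cancel]

/-- Adjoining an element `x` with `-x ∉ T` to a preordering `T` of a field gives a
preordering. -/
theorem exists_subsemiring_insert {F : Type*} [Field F] (T : Subsemiring F)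
    (hsq : ∀ y : F, y ^ 2 ∈ T) (hneg : -1 ∉ T) {x : F} (hx : -x ∉ T) :
    ∃ T' : Subsemiring F, T ≤ T' ∧ x ∈ T' ∧ -1 ∉ T' := by
  refine ⟨{ carrier := {z | ∃ p ∈ T, ∃ q ∈ T, z = p + x * q}
            zero_mem' := ⟨0, zero_mem _, 0, zero_mem _, by ring⟩
            one_mem' := ⟨1, one_mem _, 0, zero_mem _, by ring⟩
            add_mem' := ?_
            mul_mem' := ?_ }, ?_, ?_, ?_⟩
  · rintro _ _ ⟨p, hp, q, hq, rfl⟩ ⟨r, hr, s, hs, rfl⟩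
    exact ⟨p * r + x ^ 2 * (q * s), add_mem (mul_mem hp hr) (mul_mem (hsq x) (mul_mem hq hs)),
      p * s + q * r, add_mem (mul_mem hp hs) (mul_mem hq hr), by ring⟩
  · rintro _ _ ⟨p, hp, q, hq, rfl⟩ ⟨r, hr, s, hs, rfl⟩
    exact ⟨p + r, add_mem hp hr, q + s, add_mem hq hs, by ring⟩
  · exact fun p hp => ⟨p, hp, 0, zero_mem _, by ring⟩
  · exact ⟨0, zero_mem _, 1, one_mem _, by ring⟩
  · rintro ⟨p, hp, q, hq, e⟩
    have hq0 : q ≠ 0 := by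
      rintro rfl
      exact hneg (by simpa [e] using hp)
    apply hx
    have : -x = (1 + p) * q * (q⁻¹) ^ 2 := by
      field_simp
      linear_combination e
    rw [this]
    exact mul_mem (mul_mem (add_mem (one_mem _) hp) hq) (hsq _)

/-- Artin's extension theorem: a preordering of a field is contained in the cone of nonnegative
elements of a field ordering. -/
theorem exists_linearOrder_of_subsemiring {F : Type*} [Field F] (T : Subsemiring F)
    (hsq : ∀ y : F, y ^ 2 ∈ T) (hneg : -1 ∉ T) :
    ∃ _ : LinearOrder F, IsStrictOrderedRing F ∧ ∀ x ∈ T, 0 ≤ x := by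
  classical
  obtain ⟨M, hTM, hM⟩ := zorn_le_nonempty₀ {M : Subsemiring F | -1 ∉ M} (by
    intro c hc hchain y hy
    refine ⟨sSup c, ?_, fun z hz => le_sSup hz⟩
    change -1 ∉ sSup c
    rw [Subsemiring.mem_sSup_of_directedOn ⟨y, hy⟩ hchain.directedOn]
    rintro ⟨s, hs, h⟩
    exact hc hs h) T hneg
  have hM1 : -1 ∉ M := hM.prop
  have hMsq : ∀ y : F, y ^ 2 ∈ M := fun y => hTM (hsq y)
  have htot : ∀ x, x ∈ M ∨ -x ∈ M := by
    intro x
    by_contra! h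
    obtain ⟨T', hle, hxT, hT'⟩ := exists_subsemiring_insert M hMsq hM1 h.2
    exact h.1 (hM.le_of_ge hT' hle hxT)
  let C : RingCone F :=
    { M with
      eq_zero_of_mem_of_neg_mem' := by
        intro x hx hx'
        by_contra h0
        apply hM1
        have : (-1 : F) = x * (-x) * (x⁻¹) ^ 2 := by field_simp
        rw [this]
        exact M.mul_mem (M.mul_mem hx hx') (hMsq _) }
  have : HasMemOrNegMem C := ⟨htot⟩
  let : LinearOrder F := LinearOrder.mkOfAddGroupCone C
  have : IsOrderedRing F := IsOrderedRing.mkOfCone C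
  refine ⟨inferInstance, IsOrderedRing.toIsStrictOrderedRing F, fun x hx => ?_⟩
  change x - 0 ∈ C
  rw [sub_zero]
  exact hTM hx

open Polynomial in
/-- The intermediate value theorem for polynomials over a maximal ordered field. -/
theorem IsMaximalOrdered.exists_mem_Ioo_isRoot {K : Type u} [Field K] [LinearOrder K]
    [IsStrictOrderedRing K] (hmax : IsMaximalOrdered K) {a b : K} (hab : a < b) (H : K[X])
    (hH : H.eval a * H.eval b < 0) : ∃ c ∈ Set.Ioo a b, H.IsRoot c := by
  obtain ⟨P, hP, hPH, hs⟩ := exists_irreducible_dvd_eval_mul_eval_neg H hH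
  have : Fact (Irreducible P) := ⟨hP⟩
  obtain ⟨_, _, hle⟩ := exists_linearOrder_of_subsemiring
    (nonnegSMulSq K (AdjoinRoot P)).subsemiringClosure
    (fun y => by simpa using algebraMap_mul_sq_mem_subsemiringClosure (zero_le_one' K) y)
    (neg_one_notMem_subsemiringClosure_adjoinRoot P hP hs)
  have hmono : StrictMono (algebraMap K (AdjoinRoot P)) := by
    refine Monotone.strictMono_of_injective (fun x y hxy => ?_) (algebraMap K _).injective
    rw [← sub_nonneg, ← map_sub]
    have h := hle _ (algebraMap_mul_sq_mem_subsemiringClosure (sub_nonneg.2 hxy) 1)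
    rwa [one_pow, mul_one] at h
  have : FiniteDimensional K (AdjoinRoot P) := (AdjoinRoot.powerBasis hP.ne_zero).finite
  obtain ⟨c, hc⟩ := hmax (AdjoinRoot P) hmono inferInstance (AdjoinRoot.root P)
  have hroot : P.IsRoot c := by
    apply (algebraMap K (AdjoinRoot P)).injective
    rw [map_zero, ← AdjoinRoot.eval₂_root P, ← AdjoinRoot.algebraMap_eq, ← hc, eval₂_at_apply]
  refine ⟨c, ?_, hroot.dvd hPH⟩
  -- An irreducible polynomial with a root is linear.
  obtain ⟨G, hG⟩ := dvd_iff_isRoot.2 hroot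
  obtain ⟨r, -, rfl⟩ := Polynomial.isUnit_iff.1
    ((hP.isUnit_or_isUnit hG).resolve_left (not_isUnit_X_sub_C c))
  rw [hG] at hs
  simp only [eval_mul, eval_sub, eval_X, eval_C] at hs
  have h : (a - c) * (b - c) < 0 := by
    by_contra! h
    nlinarith [mul_nonneg h (mul_self_nonneg r)]
  constructor
  · by_contra! h'
    exact h.not_ge (mul_nonneg (sub_nonneg.2 h') (by linarith))
  · by_contra! h'
    exact h.not_ge (mul_nonneg_of_nonpos_of_nonpos (by linarith) (by linarith))

/-! ### The Archimedean valuation and the order topology -/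

open ArchimedeanClass

/-- The Archimedean valuation, written additively: `𝓋 x < 𝓋 y` says that `y` is negligible with
respect to `x`. -/
local notation "𝓋" => ArchimedeanClass.mk

theorem exists_archimedeanClass_mk_pos {K : Type u} [Field K] [LinearOrder K]
    [IsStrictOrderedRing K] (hna : ¬ Archimedean K) : ∃ t : K, t ≠ 0 ∧ 0 < 𝓋 t := by
  by_contra! h
  refine hna (archimedean_of_mk_eq_mk fun a ha b hb => le_antisymm ?_ ?_)
  · have h1 := add_le_add_left (h (a / b) (div_ne_zero ha hb)) (𝓋 b)
    rwa [← mk_mul, div_mul_cancel₀ a hb, zero_add] at h1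
  · have h1 := add_le_add_left (h (b / a) (div_ne_zero hb ha)) (𝓋 a)
    rwa [← mk_mul, div_mul_cancel₀ b ha, zero_add] at h1

theorem abs_lt_abs_of_archimedeanClass_mk_lt {K : Type u} [Field K] [LinearOrder K]
    [IsStrictOrderedRing K] {x y : K} (h : 𝓋 y < 𝓋 x) : |x| < |y| := by
  simpa using mk_lt_mk.1 h 1

theorem archimedeanClass_mk_mul_le_mk_mul_iff {K : Type u} [Field K] [LinearOrder K]
    [IsStrictOrderedRing K] {x y z : K} (hz : z ≠ 0) :
    𝓋 (x * z) ≤ 𝓋 (y * z) ↔ 𝓋 x ≤ 𝓋 y := by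
  have key : ∀ {x y z : K}, 𝓋 x ≤ 𝓋 y → 𝓋 (x * z) ≤ 𝓋 (y * z) := fun {x y z} h => by
    rw [mk_mul, mk_mul]
    exact add_le_add_left h _
  refine ⟨fun h => ?_, key⟩
  simpa [mul_assoc, hz] using key (z := z⁻¹) h

theorem archimedeanClass_mk_lt_mk_mul {K : Type u} [Field K] [LinearOrder K]
    [IsStrictOrderedRing K] {t x : K} (ht : 0 < 𝓋 t) (hx : x ≠ 0) : 𝓋 x < 𝓋 (t * x) := by
  rw [← not_le]
  nth_rewrite 2 [← one_mul x]
  rw [archimedeanClass_mk_mul_le_mk_mul_iff hx, mk_one]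
  exact ht.not_ge

/-- In a non-Archimedean ordered field, the balls of the Archimedean valuation are neighbourhoods of
zero for the order topology. -/
theorem eventually_archimedeanClass_mk_lt {K : Type u} [Field K] [LinearOrder K]
    [IsStrictOrderedRing K] [TopologicalSpace K] [OrderTopology K] (hna : ¬ Archimedean K) {δ : K}
    (hδ : δ ≠ 0) : ∀ᶠ x in 𝓝 (0 : K), 𝓋 δ < 𝓋 x := by
  obtain ⟨t, ht0, ht⟩ := exists_archimedeanClass_mk_pos hna
  have h := (nhds_basis_abs_sub_lt (0 : K)).mem_of_mem (abs_pos.2 (mul_ne_zero ht0 hδ))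
  filter_upwards [h] with x hx
  rw [sub_zero] at hx
  exact (archimedeanClass_mk_lt_mk_mul ht hδ).trans_le (mk_le_mk_of_abs hx.le)

/-! ### Truncations of power series with coefficients tending to zero -/

/-- If the coefficients of `S` tend to zero, its polynomial truncations form a Cauchy sequence
uniformly on the unit ball. -/
theorem exists_forall_archimedeanClass_mk_lt_eval_trunc_sub {K : Type u} [Field K] [LinearOrder K]
    [IsStrictOrderedRing K] [TopologicalSpace K] [OrderTopology K] (hna : ¬ Archimedean K)
    {S : PowerSeries K} (hS : Tendsto (fun n => PowerSeries.coeff n S) atTop (𝓝 0)) {δ : K}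
    (hδ : δ ≠ 0) : ∃ n₀, ∀ m n, n₀ ≤ m → m ≤ n → ∀ x : K, 0 ≤ 𝓋 x →
      𝓋 δ < 𝓋 ((S.trunc n).eval x - (S.trunc m).eval x) := by
  obtain ⟨n₀, h⟩ := eventually_atTop.1
    (hS.eventually (eventually_archimedeanClass_mk_lt hna hδ))
  refine ⟨n₀, fun m n hm hn x hx => ?_⟩
  rw [Polynomial.eval, Polynomial.eval, PowerSeries.eval₂_trunc_eq_sum_range,
    PowerSeries.eval₂_trunc_eq_sum_range, ← Finset.sum_Ico_eq_sub _ hn]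
  refine (addValuation K).map_lt_sum (by simpa using hδ) fun i hi => ?_
  simp only [addValuation_apply, RingHom.id_apply, mk_mul, mk_pow]
  exact (h i (hm.trans (Finset.mem_Ico.1 hi).1)).trans_le
    (le_add_of_nonneg_right (nsmul_nonneg hx i))

/-- Some nonzero coefficient strictly dominates all later ones. It need not be a dominant
coefficient of `S`: the earlier ones are unconstrained. -/
theorem exists_archimedeanClass_mk_coeff_lt {K : Type u} [Field K] [LinearOrder K]
    [IsStrictOrderedRing K] [TopologicalSpace K] [OrderTopology K] (hna : ¬ Archimedean K)
    {S : PowerSeries K} (hS : Tendsto (fun n => PowerSeries.coeff n S) atTop (𝓝 0)) (hS0 : S ≠ 0) :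
    ∃ N, PowerSeries.coeff N S ≠ 0 ∧
      ∀ n, N < n → 𝓋 (PowerSeries.coeff N S) < 𝓋 (PowerSeries.coeff n S) := by
  obtain ⟨m, hm⟩ : ∃ m, PowerSeries.coeff m S ≠ 0 := by
    by_contra! h
    exact hS0 (PowerSeries.ext fun n => by simpa using h n)
  obtain ⟨n₀, h⟩ := eventually_atTop.1
    (hS.eventually (eventually_archimedeanClass_mk_lt hna hm))
  set p : ℕ → Prop := fun n => 𝓋 (PowerSeries.coeff n S) ≤ 𝓋 (PowerSeries.coeff m S)
  have hpb : ∀ n, p n → n ≤ n₀ := fun n hn => by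
    by_contra! h'
    exact (h n h'.le).not_ge hn
  classical
  have hpm : p m := le_rfl
  have hN : p (Nat.findGreatest p n₀) := Nat.findGreatest_spec (hpb m hpm) hpm
  refine ⟨Nat.findGreatest p n₀, fun h0 => ?_, fun n hn => ?_⟩
  · have hN' : 𝓋 (PowerSeries.coeff (Nat.findGreatest p n₀) S) ≤
        𝓋 (PowerSeries.coeff m S) := hN
    rw [h0, mk_zero, top_le_iff, mk_eq_top_iff] at hN'
    exact hm hN'
  · refine lt_of_le_of_lt hN (not_le.1 fun hle => ?_)
    exact hn.not_ge (Nat.le_findGreatest (hpb n hle) hle)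

/-! ### Covering sublevel sets of polynomials -/

open Polynomial in
/-- If the coefficient of index `N` of a polynomial strictly dominates all later ones, then on the
unit ball a sublevel set at a level negligible with respect to `α * η ^ N` is covered by finitely
many (in fact `N`) balls of radius `η`. Inductively,
divide by `X - x₀` for a point `x₀` of the sublevel set: away from `x₀`, the quotient is small where
the polynomial is, and its coefficient of index `N - 1` strictly dominates all later ones. -/
theorem exists_finite_cover_of_archimedeanClass_mk_eval {K : Type u} [Field K] [LinearOrder K]
    [IsStrictOrderedRing K] {α η : K} (hα : α ≠ 0) (hη : η ≠ 0) (N : ℕ) (P : K[X]) (ε : K)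
    (hN : 𝓋 (P.coeff N) = 𝓋 α)
    (hP : ∀ n, N < n → 𝓋 α < 𝓋 (P.coeff n))
    (hε : 𝓋 (α * η ^ N) < 𝓋 ε) :
    ∃ F : Set K, F.Finite ∧ ∀ x : K, 0 ≤ 𝓋 x → 𝓋 ε ≤ 𝓋 (P.eval x) →
      ∃ y ∈ F, 𝓋 η < 𝓋 (x - y) := by
  have hαt : 𝓋 α ≠ ⊤ := by simpa using hα
  induction N generalizing P ε with
  | zero =>
    refine ⟨∅, Set.finite_empty, fun x hx hxP => ?_⟩
    have h : 𝓋 α < 𝓋 (P.eval x - P.coeff 0) := by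
      rw [eval_eq_sum_range, Finset.sum_range_succ', pow_zero, mul_one, add_sub_cancel_right]
      refine (addValuation K).map_lt_sum hαt fun i _ => ?_
      simp only [addValuation_apply, mk_mul, mk_pow]
      exact (hP (i + 1) i.succ_pos).trans_le (le_add_of_nonneg_right (nsmul_nonneg hx _))
    rw [pow_zero, mul_one] at hε
    rw [← mk_neg (P.eval x - P.coeff 0), neg_sub] at h
    have h2 := (addValuation K).map_lt_add (hε.trans_le hxP) h
    rw [add_sub_cancel, addValuation_apply, hN] at h2
    exact absurd h2 (lt_irrefl _)
  | succ N ih =>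
    by_cases hx₀ : ∃ x₀ : K, 0 ≤ 𝓋 x₀ ∧ 𝓋 ε ≤ 𝓋 (P.eval x₀)
    swap
    · push Not at hx₀
      exact ⟨∅, Set.finite_empty, fun x hx hxP => absurd hxP (hx₀ x hx).not_ge⟩
    obtain ⟨x₀, hx₀, hPx₀⟩ := hx₀
    have hcoeff : ∀ n, N ≤ n → 𝓋 α < 𝓋 ((P /ₘ (X - C x₀)).coeff n - P.coeff (n + 1)) := by
      intro n hn
      rw [coeff_divByMonic_X_sub_C_rec, add_sub_cancel_left, coeff_divByMonic_X_sub_C,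
        Finset.mul_sum]
      refine (addValuation K).map_lt_sum hαt fun i hi => ?_
      simp only [addValuation_apply, mk_mul, mk_pow]
      have h1 := hP i (by have := (Finset.mem_Icc.1 hi).1; omega)
      exact h1.trans_le (le_add_of_nonneg_of_le hx₀
        (le_add_of_nonneg_left (nsmul_nonneg hx₀ _)))
    obtain ⟨F, hF, hcover⟩ := ih (P /ₘ (X - C x₀)) (ε * η⁻¹)
      (by
        rw [← sub_add_cancel ((P /ₘ (X - C x₀)).coeff N) (P.coeff (N + 1)), add_comm,
          mk_add_eq_mk_left (by rw [hN]; exact hcoeff N le_rfl), hN])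
      (fun n hn => by
        rw [← sub_add_cancel ((P /ₘ (X - C x₀)).coeff n) (P.coeff (n + 1))]
        exact (addValuation K).map_lt_add (hcoeff n hn.le) (hP (n + 1) (by omega)))
      (by
        rw [← not_le, ← archimedeanClass_mk_mul_le_mk_mul_iff hη, inv_mul_cancel_right₀ hη,
          mul_assoc, ← pow_succ, not_le]
        exact hε)
    refine ⟨insert x₀ F, hF.insert x₀, fun x hx hPx => ?_⟩
    by_cases hclose : 𝓋 η < 𝓋 (x - x₀)
    · exact ⟨x₀, Set.mem_insert _ _, hclose⟩
    have hmul : P.eval x - P.eval x₀ = (P /ₘ (X - C x₀)).eval x * (x - x₀) := by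
      have h := congrArg (eval x) (modByMonic_add_div P (X - C x₀))
      rw [modByMonic_X_sub_C_eq_C_eval] at h
      simp only [eval_add, eval_mul, eval_C, eval_sub, eval_X] at h
      linear_combination -h
    have hle : 𝓋 ε ≤ 𝓋 ((P /ₘ (X - C x₀)).eval x * (x - x₀)) := by
      rw [← hmul]
      exact (addValuation K).map_le_sub hPx hPx₀
    obtain ⟨y, hy, hxy⟩ := hcover x hx (by
      rw [← archimedeanClass_mk_mul_le_mk_mul_iff hη, inv_mul_cancel_right₀ hη]
      refine hle.trans ?_
      rw [mk_mul, mk_mul]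
      exact add_le_add_right (not_lt.1 hclose) _)
    exact ⟨y, Set.mem_insert_of_mem _ hy, hxy⟩

/-! ### Roots of truncations and roots of the series -/

theorem PowerSeries.convergesAtTo_iff_tendsto_eval_trunc {K : Type u} [Field K]
    [TopologicalSpace K] {S : PowerSeries K} {x s : K} :
    S.ConvergesAtTo x s ↔ Tendsto (fun n => (S.trunc (n + 1)).eval x) atTop (𝓝 s) := by
  simp only [ConvergesAtTo, Polynomial.eval, PowerSeries.eval₂_trunc_eq_sum_range,
    RingHom.id_apply]

/-- Roots of the truncations of `S` accumulate: by the covering of sublevel sets they form a totally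
bounded sequence. -/
theorem exists_clusterPt_of_eval_trunc_eq_zero {K : Type u} [Field K] [LinearOrder K]
    [IsStrictOrderedRing K] [UniformSpace K] [IsUniformAddGroup K] [OrderTopology K]
    [CompleteSpace K] (hna : ¬ Archimedean K) {S : PowerSeries K}
    (hS : Tendsto (fun n => PowerSeries.coeff n S) atTop (𝓝 0)) (hS0 : S ≠ 0) {c : ℕ → K}
    (hc : ∀ᶠ n in atTop, 0 ≤ 𝓋 (c n) ∧ (S.trunc (n + 1)).eval (c n) = 0) :
    ∃ x, ClusterPt x (map c atTop) := by
  refine Filter.TotallyBounded.exists_clusterPt fun d hd => ?_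
  obtain ⟨t, ht0, ht⟩ := exists_archimedeanClass_mk_pos hna
  obtain ⟨N, hN, hlt⟩ := exists_archimedeanClass_mk_coeff_lt hna hS hS0
  rw [uniformity_eq_comap_nhds_zero, mem_comap] at hd
  obtain ⟨U, hU, hUd⟩ := hd
  obtain ⟨η, hη, hηU⟩ := (nhds_basis_abs_sub_lt (0 : K)).mem_iff.1 hU
  have hε := mul_ne_zero hN (pow_ne_zero N hη.ne')
  obtain ⟨n₀, htail⟩ := exists_forall_archimedeanClass_mk_lt_eval_trunc_sub hna hS
    (mul_ne_zero ht0 hε)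
  obtain ⟨n₁, hc⟩ := eventually_atTop.1 hc
  set M := max N (max n₀ n₁)
  obtain ⟨F, hF, hcover⟩ := exists_finite_cover_of_archimedeanClass_mk_eval hN hη.ne' N
    (S.trunc (M + 1)) _
    (by rw [PowerSeries.coeff_trunc, if_pos (by omega)])
    (fun n hn => by
      rw [PowerSeries.coeff_trunc]
      split_ifs
      · exact hlt n hn
      · rw [mk_zero, lt_top_iff_ne_top]
        simpa using hN)
    (archimedeanClass_mk_lt_mk_mul ht hε)
  refine ⟨F, hF, ?_⟩
  rw [mem_map]
  filter_upwards [eventually_ge_atTop M] with n hn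
  obtain ⟨hcn, hroot⟩ := hc n (by omega)
  have h := htail (M + 1) (n + 1) (by omega) (by omega) (c n) hcn
  rw [hroot, zero_sub, mk_neg] at h
  obtain ⟨y, hy, hxy⟩ := hcover (c n) hcn h.le
  refine ⟨y, hy, hUd (hηU ?_)⟩
  have := abs_lt_abs_of_archimedeanClass_mk_lt hxy
  rw [abs_of_pos hη, abs_sub_comm] at this
  simpa using this

/-- A cluster point of roots of the truncations of `S` is a root of `S`. -/
theorem eq_zero_of_clusterPt_of_convergesAtTo {K : Type u} [Field K] [LinearOrder K]
    [IsStrictOrderedRing K] [TopologicalSpace K] [OrderTopology K]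
    (hna : ¬ Archimedean K) {S : PowerSeries K}
    (hS : Tendsto (fun n => PowerSeries.coeff n S) atTop (𝓝 0)) {c : ℕ → K}
    (hc : ∀ᶠ n in atTop, 0 ≤ 𝓋 (c n) ∧ (S.trunc (n + 1)).eval (c n) = 0) {x s : K}
    (hx : 0 ≤ 𝓋 x) (hcx : ClusterPt x (map c atTop)) (hs : S.ConvergesAtTo x s) : s = 0 := by
  by_contra hs0
  obtain ⟨n₀, htail⟩ := exists_forall_archimedeanClass_mk_lt_eval_trunc_sub hna hS hs0
  -- For this truncation `P`, the differences `P(c n)`, `P(x) - P(c n)` and `s - P(x)` are all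
  -- negligible with respect to `s`.
  set P := S.trunc (n₀ + 1)
  have h1 : ∀ᶠ y in 𝓝 x, 𝓋 s < 𝓋 (P.eval x - P.eval y) := by
    have : Tendsto (fun y => P.eval x - P.eval y) (𝓝 x) (𝓝 0) := by
      simpa using (tendsto_const_nhds (x := P.eval x)).sub (P.continuous.tendsto x)
    exact this.eventually (eventually_archimedeanClass_mk_lt hna hs0)
  have h2 : ∀ᶠ y in map c atTop, 𝓋 s < 𝓋 (P.eval y) := by
    rw [eventually_map]
    filter_upwards [hc, eventually_ge_atTop n₀] with n hn hle
    have h := htail (n₀ + 1) (n + 1) (by omega) (by omega) (c n) hn.1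
    rwa [hn.2, zero_sub, mk_neg] at h
  obtain ⟨y, hy, hPy⟩ := ((hcx.frequently h1).and_eventually h2).exists
  have h3 : 𝓋 s < 𝓋 (P.eval x) := by
    have := (addValuation K).map_lt_add hy hPy
    rwa [sub_add_cancel] at this
  have h4 : ∀ᶠ n in atTop, 𝓋 s < 𝓋 (s - (S.trunc (n + 1)).eval x) := by
    have : Tendsto (fun n => s - (S.trunc (n + 1)).eval x) atTop (𝓝 0) := by
      simpa using (tendsto_const_nhds (x := s)).sub
        (PowerSeries.convergesAtTo_iff_tendsto_eval_trunc.1 hs)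
    exact this.eventually (eventually_archimedeanClass_mk_lt hna hs0)
  obtain ⟨n, hn, hle⟩ := (h4.and (eventually_ge_atTop n₀)).exists
  have h5 := (addValuation K).map_lt_add
    ((addValuation K).map_lt_add hn (htail (n₀ + 1) (n + 1) (by omega) (by omega) x hx)) h3
  rw [sub_add_sub_cancel, sub_add_cancel] at h5
  exact lt_irrefl _ h5

/-- The case of a power series with coefficients tending to zero, on a subinterval of the unit
ball. -/
theorem PowerSeries.exists_mem_Ioo_convergesAtTo_zero_of_tendsto_coeff {K : Type u} [Field K]
    [LinearOrder K] [IsStrictOrderedRing K]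
    [UniformSpace K] [IsUniformAddGroup K] [OrderTopology K] [CompleteSpace K]
    (hna : ¬ Archimedean K) (hmax : IsMaximalOrdered K) (S : PowerSeries K)
    (hS : Tendsto (fun n => PowerSeries.coeff n S) atTop (𝓝 0)) (a b : K) (hab : a < b)
    (hball : ∀ x ∈ Set.Icc a b, 0 ≤ 𝓋 x)
    (hconv : ∀ x ∈ Set.Icc a b, ∃ s, S.ConvergesAtTo x s)
    (sa sb : K) (ha : S.ConvergesAtTo a sa) (hb : S.ConvergesAtTo b sb) (hsign : sa * sb < 0) :
    ∃ c ∈ Set.Ioo a b, S.ConvergesAtTo c 0 := by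
  have ha' := convergesAtTo_iff_tendsto_eval_trunc.1 ha
  have hb' := convergesAtTo_iff_tendsto_eval_trunc.1 hb
  have hev := (ha'.mul hb').eventually (gt_mem_nhds hsign)
  have hS0 : S ≠ 0 := by
    rintro rfl
    obtain ⟨n, hn⟩ := hev.exists
    simp at hn
  have hroot : ∀ n, ∃ c, (S.trunc (n + 1)).eval a * (S.trunc (n + 1)).eval b < 0 →
      c ∈ Set.Ioo a b ∧ (S.trunc (n + 1)).eval c = 0 := by
    intro n
    by_cases h : (S.trunc (n + 1)).eval a * (S.trunc (n + 1)).eval b < 0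
    · obtain ⟨c, hc, hr⟩ := hmax.exists_mem_Ioo_isRoot hab _ h
      exact ⟨c, fun _ => ⟨hc, hr⟩⟩
    · exact ⟨0, fun h' => absurd h' h⟩
  choose c hc using hroot
  have hmem : ∀ᶠ n in atTop, c n ∈ Set.Icc a b :=
    hev.mono fun n hn => Set.Ioo_subset_Icc_self (hc n hn).1
  have hc' : ∀ᶠ n in atTop, 0 ≤ 𝓋 (c n) ∧ (S.trunc (n + 1)).eval (c n) = 0 := by
    filter_upwards [hev, hmem] with n hn hn'
    exact ⟨hball _ hn', (hc n hn).2⟩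
  obtain ⟨x, hx⟩ := exists_clusterPt_of_eval_trunc_eq_zero hna hS hS0 hc'
  have hxI : x ∈ Set.Icc a b :=
    isClosed_Icc.mem_of_frequently_of_tendsto (b := 𝓝 x ⊓ Filter.map c atTop) (f := id) (by
      have : (𝓝 x ⊓ Filter.map c atTop).NeBot := hx
      have h : ∀ᶠ y in 𝓝 x ⊓ Filter.map c atTop, y ∈ Set.Icc a b :=
        (eventually_map.2 hmem).filter_mono inf_le_right
      exact h.frequently) inf_le_left
  obtain ⟨s, hs⟩ := hconv x hxI
  obtain rfl := eq_zero_of_clusterPt_of_convergesAtTo hna hS hc' (hball x hxI) hx hs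
  refine ⟨x, ⟨lt_of_le_of_ne hxI.1 ?_, lt_of_le_of_ne hxI.2 ?_⟩, hs⟩
  · rintro rfl
    simp [tendsto_nhds_unique ha hs] at hsign
  · rintro rfl
    simp [tendsto_nhds_unique hb hs] at hsign

/-! ### Reduction to the unit ball -/

theorem PowerSeries.convergesAtTo_rescale_iff {K : Type u} [Field K]
    [TopologicalSpace K] {S : PowerSeries K} {r x s : K} :
    (PowerSeries.rescale r S).ConvergesAtTo x s ↔ S.ConvergesAtTo (r * x) s := by
  simp only [ConvergesAtTo, PowerSeries.coeff_rescale, mul_pow]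
  simp only [mul_comm, mul_assoc, mul_left_comm]

theorem PowerSeries.ConvergesAtTo.tendsto_coeff_mul_pow {K : Type u} [Field K]
    [TopologicalSpace K] [IsTopologicalRing K] {S : PowerSeries K} {x s : K}
    (h : S.ConvergesAtTo x s) :
    Tendsto (fun n => PowerSeries.coeff n S * x ^ n) atTop (𝓝 0) := by
  have h' : Tendsto (fun n : ℕ => ∑ i ∈ Finset.range n, PowerSeries.coeff i S * x ^ i) atTop
    (𝓝 s) := (tendsto_add_atTop_iff_nat 1).1 h
  have := Tendsto.sub h h'
  simpa [Finset.sum_range_succ] using this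

theorem theorem6p1 {K : Type u} [Field K] [LinearOrder K] [IsStrictOrderedRing K]
    [UniformSpace K] [IsUniformAddGroup K] [OrderTopology K] [CompleteSpace K]
    (hna : ¬ Archimedean K) (hmax : IsMaximalOrdered K)
    (hcount : (𝓝 (0 : K)).IsCountablyGenerated)
    (S : PowerSeries K) (a b : K) (hab : a < b)
    (hconv : ∀ x ∈ Set.Icc a b, ∃ s, S.ConvergesAtTo x s)
    (sa sb : K) (ha : S.ConvergesAtTo a sa) (hb : S.ConvergesAtTo b sb) (hsign : sa * sb < 0) :
    ∃ c ∈ Set.Ioo a b, S.ConvergesAtTo c 0 := by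
  -- Rescale by the absolute value `r` of an endpoint `e` of maximal absolute value.
  obtain ⟨e, se, he, hae, hbe⟩ : ∃ e se, S.ConvergesAtTo e se ∧ |a| ≤ |e| ∧ |b| ≤ |e| := by
    rcases le_total |a| |b| with h | h
    · exact ⟨b, sb, hb, h, le_rfl⟩
    · exact ⟨a, sa, ha, le_rfl, h⟩
  have hr : 0 < |e| := by
    refine abs_pos.2 ?_
    rintro rfl
    simp only [abs_zero, abs_nonpos_iff] at hae hbe
    exact hab.ne (hae.trans hbe.symm)
  set r := |e| with hre
  have hmul : ∀ x, r * (x / r) = x := fun x => mul_div_cancel₀ x hr.ne'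
  have hIcc : ∀ x ∈ Set.Icc (a / r) (b / r), r * x ∈ Set.Icc a b := fun x hx =>
    ⟨(div_le_iff₀' hr).1 hx.1, (le_div_iff₀' hr).1 hx.2⟩
  obtain ⟨c, hc, hc0⟩ := PowerSeries.exists_mem_Ioo_convergesAtTo_zero_of_tendsto_coeff hna hmax
    (PowerSeries.rescale r S)
    (by
      have h := he.tendsto_coeff_mul_pow.abs
      rw [abs_zero] at h
      refine (tendsto_zero_iff_abs_tendsto_zero _).2 (h.congr fun n => ?_)
      simp [PowerSeries.coeff_rescale, abs_mul, abs_pow, hre, mul_comm])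
    (a / r) (b / r) ((div_lt_div_iff_of_pos_right hr).2 hab)
    (fun x hx => by
      have h := hIcc x hx
      have h1 : |r * x| ≤ r :=
        abs_le.2 ⟨(neg_le_of_abs_le hae).trans h.1, h.2.trans (le_of_abs_le hbe)⟩
      rw [abs_mul, abs_of_pos hr] at h1
      have h2 : |x| ≤ |1| := by
        rw [abs_one]
        exact le_of_mul_le_mul_left (by simpa using h1) hr
      simpa using mk_le_mk_of_abs h2)
    (fun x hx => by
      obtain ⟨s, hs⟩ := hconv _ (hIcc x hx)
      exact ⟨s, PowerSeries.convergesAtTo_rescale_iff.2 hs⟩)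
    sa sb (PowerSeries.convergesAtTo_rescale_iff.2 (by rwa [hmul]))
    (PowerSeries.convergesAtTo_rescale_iff.2 (by rwa [hmul])) hsign
  exact ⟨r * c, ⟨(div_lt_iff₀' hr).1 hc.1, (lt_div_iff₀' hr).1 hc.2⟩,
    PowerSeries.convergesAtTo_rescale_iff.1 hc0⟩
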